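/- All topological spaces are assumed to be Tychonoff. For a space $X$, let $C_k(X)$ be the space of all continuous functions $X\to\mathbb R$ with the compact-open topology. $X$ is called Ascoli if every compact subset $\mathcal K$ of $C_k(X)$ is evenly continuous, i.e. the map $X\times\mathcal K\to\mathbb R$, $(x,f)\mapsto f(x)$, is continuous; $X$ is called sequentially Ascoli if every convergent sequence in $C_k(X)$ is equicontinuous. A subset $A\subseteq X$ is functionally bounded if every continuous $f:X\to\mathbb R$ is bounded on $A$, and $X$ is a $\mu$-space if every functionally bounded subset of $X$ has compact closure. Let $\beta X$ be the Stone–Čech compactification of $X$, and consider the following subspaces of $\beta X$ containing $X$: - the $\mu$-completion $\mu X$ is the smallest subspace of $\beta X$ that contains $X$ and is a $\mu$-space; - the Dieudonné completion $\mathcal DX$ is the completion of $X$ with respect to its universal uniformity (the finest uniformity inducing the topology of $X$), i.e. the set of all $p\in\beta X$ for which the trace on $X$ of the neighbourhood filter of $p$ is a Cauchy filter for this uniformity; - the Hewitt realcompactification $\upsilon X$ is the set of all $p\in\beta X$ such that every continuous $f:X\to\mathbb R$ extends continuously, with a value in $\mathbb R$, to $X\cup\{p\}$. **Theorem.** Let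 $X$ be a Tychonoff space and let $X\subseteq Y\subseteq\beta X$. (i) If $X$ is Ascoli and $Y\subseteq\mathcal DX$, then $Y$ is Ascoli. (ii) If $X$ is sequentially Ascoli and $Y\subseteq\upsilon X$, then $Y$ is sequentially Ascoli. In particular, if $X$ is Ascoli, then $\mu X$ and $\mathcal DX$ are Ascoli; and if $X$ is sequentially Ascoli, then $\mu X$ and $\mathcal DX$ are sequentially Ascoli. -/

import Mathlib

open Set Filter Topology

universe u

/-- `X` is an Ascoli space: every compact subset `K` of `C(X, ℝ)`, endowed with the compact-open
topology, is evenly continuous, i.e. the evaluation map `X × K → ℝ` is (jointly) continuous. -/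
def IsAscoliSpace (X : Type u) [TopologicalSpace X] : Prop :=
  ∀ K : Set C(X, ℝ), IsCompact K → Continuous fun p : X × K => (p.2 : C(X, ℝ)) p.1

/-- `X` is a sequentially Ascoli space: every convergent sequence in `C(X, ℝ)`, endowed with the
compact-open topology, is equicontinuous. -/
def IsSequentiallyAscoliSpace (X : Type u) [TopologicalSpace X] : Prop :=
  ∀ (f : ℕ → C(X, ℝ)) (g : C(X, ℝ)), Tendsto f atTop (𝓝 g) →
    Equicontinuous fun (n : ℕ) (x : X) => f n x

/-- A subset `A` of `X` is functionally bounded in `X` if every continuous real-valued function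
on `X` is bounded on `A`. -/
def IsFunctionallyBounded {X : Type u} [TopologicalSpace X] (A : Set X) : Prop :=
  ∀ f : C(X, ℝ), Bornology.IsBounded (f '' A)

/-- `X` is a `μ`-space: every functionally bounded subset of `X` has compact closure. -/
def IsMuSpace (X : Type u) [TopologicalSpace X] : Prop :=
  ∀ A : Set X, IsFunctionallyBounded A → IsCompact (closure A)

/-- The `μ`-completion of `X`: the smallest subspace of the Stone-Čech compactification that
contains `X` and is a `μ`-space (see `isLeast_muCompletion`). -/
def muCompletion (X : Type u) [TopologicalSpace X] : Set (StoneCech X) :=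
  ⋂₀ {Z | range (stoneCechUnit : X → StoneCech X) ⊆ Z ∧ IsMuSpace Z}

/-- The universal (fine) uniformity of a completely regular space: the finest among the uniformities
that induce its topology. In Mathlib's order the finer uniformity is the smaller one. -/
@[reducible] def fineUniformity (X : Type u) [t : TopologicalSpace X] : UniformSpace X :=
  sInf {v : UniformSpace X | v.toTopologicalSpace = t}

/-- The Dieudonné completion of `X`, i.e. the completion of `X` with respect to its universal
uniformity, as a subspace of the Stone-Čech compactification: a point `p` belongs to it
if and only if the trace on `X` of the neighbourhood filter of `p` is a Cauchy filter for the
universal uniformity. -/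
def dieudonneCompletion (X : Type u) [TopologicalSpace X] : Set (StoneCech X) :=
  {p | @Cauchy X (fineUniformity X) (comap stoneCechUnit (𝓝 p))}

/-- The Hewitt realcompactification of `X`, as a subspace of the Stone-Čech compactification:
the set of all points `p` such that every continuous real-valued function on `X` extends
continuously (with a finite value) to `p`. -/
def hewittRealcompactification (X : Type u) [TopologicalSpace X] : Set (StoneCech X) :=
  {p | ∀ f : C(X, ℝ), ∃ r : ℝ, Tendsto f (comap stoneCechUnit (𝓝 p)) (𝓝 r)}

/-- The universal uniformity of a completely regular space induces its topology, and it is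
finer than every other uniformity that does. -/
theorem isLeast_fineUniformity (X : Type u) [t : TopologicalSpace X] [CompletelyRegularSpace X] :
    IsLeast {v : UniformSpace X | v.toTopologicalSpace = t} (fineUniformity X) := by
  refine ⟨?_, fun v hv => sInf_le hv⟩
  obtain ⟨v, hv⟩ := CompletelyRegularSpace.exists_uniformSpace (X := X)
  change (sInf _ : UniformSpace X).toTopologicalSpace = t
  rw [UniformSpace.toTopologicalSpace_sInf]
  refine le_antisymm (iInf₂_le_of_le v hv hv.le) (le_iInf₂ fun w hw => ?_)
  exact (show w.toTopologicalSpace = t from hw).ge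

/-- The `μ`-completion is indeed the smallest `μ`-subspace containing `X`. -/
theorem isLeast_muCompletion (X : Type u) [TopologicalSpace X] :
    IsLeast {Z : Set (StoneCech X) | range (stoneCechUnit : X → StoneCech X) ⊆ Z ∧ IsMuSpace Z}
      (muCompletion X) := by
  refine ⟨⟨fun x hx => mem_sInter.2 fun Z hZ => hZ.1 hx, ?_⟩, fun Z hZ => sInter_subset_of_mem hZ⟩
  intro A hA
  have key : closure (Subtype.val '' A) ⊆ muCompletion X := by
    refine subset_sInter fun Z hZ => ?_
    have hsub : muCompletion X ⊆ Z := sInter_subset_of_mem hZ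
    have hb : IsFunctionallyBounded (inclusion hsub '' A) := by
      intro f
      have := hA (f.comp ⟨inclusion hsub, continuous_inclusion hsub⟩)
      rwa [image_image]
    have hc := (hZ.2 _ hb).image continuous_subtype_val
    refine (closure_minimal ?_ hc.isClosed).trans (Subtype.coe_image_subset _ _)
    rintro _ ⟨a, ha, rfl⟩
    exact ⟨inclusion hsub a, subset_closure ⟨a, ha, rfl⟩, rfl⟩
  rw [IsInducing.subtypeVal.closure_eq_preimage_closure_image]
  refine (IsInducing.subtypeVal.isCompact_preimage_iff ?_).2 isClosed_closure.isCompact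
  simpa using key

/-! Both parts restrict functions from `Y` to the dense image of `X`, estimate there, and pass to
the limit. (i) For compact `K`, the Ascoli property makes evaluation a continuous map from `X` to
the sup-metric space of functions on the restrictions of `K`. It is uniformly continuous for the
universal uniformity, so at a point of the Dieudonné completion some trace of a neighbourhood
carries a small oscillation common to all of `K`. (ii) If `f n → g`, equicontinuity makes the
truncated tail suprema of `|f n - g|` continuous on `X`, and they tend to 0 pointwise. The sets
where they are below `δ` form a countable functionally open cover; at a point of the
realcompactification one of them is the trace of a neighbourhood, which controls a whole tail. The
Dieudonné completion is a `μ`-space because functionally bounded sets are totally bounded; hence it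
contains the `μ`-completion. -/

/-! ### Estimates passing from a dense subspace -/

section Dense

variable {X Y : Type*} [TopologicalSpace Y]

/-- Given the trace `S` of a neighbourhood of `p` on a dense subspace, some neighbourhood of `p` is
contained in all closed sets that contain `S`. -/
theorem DenseRange.exists_mem_nhds_subset_isClosed {i : X → Y} (hi : DenseRange i) {p : Y} {S : Set X}
    (hS : S ∈ comap i (𝓝 p)) : ∃ U ∈ 𝓝 p, ∀ C : Set Y, IsClosed C → (∀ x ∈ S, i x ∈ C) → U ⊆ C := by
  obtain ⟨V, hV, hVS⟩ := mem_comap.1 hS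
  obtain ⟨U, hUV, hU, hp⟩ := mem_nhds_iff.1 hV
  refine ⟨U, hU.mem_nhds hp, fun C hC h => ?_⟩
  refine (hi.subset_closure_image_preimage_of_isOpen hU).trans (closure_minimal ?_ hC)
  rintro _ ⟨x, hx, rfl⟩
  exact h x (hVS (hUV hx))

/-- If a family of functions oscillates by at most `ε` near `p` on a dense subspace, then it does
so near `p`. -/
theorem DenseRange.eventually_abs_sub_le {ι : Type*} {i : X → Y} (hi : DenseRange i) {p : Y}
    {S : Set X} (hS : S ∈ comap i (𝓝 p)) (f : ι → C(Y, ℝ)) {ε : ℝ}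
    (h : ∀ k, ∀ x ∈ S, ∀ y ∈ S, |f k (i x) - f k (i y)| ≤ ε) :
    ∀ᶠ q in 𝓝 p, ∀ k, |f k q - f k p| ≤ ε := by
  obtain ⟨U, hU, hUC⟩ := hi.exists_mem_nhds_subset_isClosed hS
  filter_upwards [hU] with q hq k
  -- The estimate extends one variable at a time, each time as a closed condition.
  have h₁ : ∀ y ∈ S, ∀ q ∈ U, |f k q - f k (i y)| ≤ ε := fun y hy =>
    hUC {q | |f k q - f k (i y)| ≤ ε} (isClosed_le (by fun_prop) continuous_const)
      fun x hx => h k x hx y hy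
  exact hUC {q' | |f k q - f k q'| ≤ ε} (isClosed_le (by fun_prop) continuous_const)
    (fun y hy => h₁ y hy q hq) (mem_of_mem_nhds hU)

end Dense

/-! ### The universal uniformity -/

section FineUniformity

variable {X : Type u} [TopologicalSpace X]

/-- Since `F` is continuous, adjoining the pullback of `uZ` to the universal uniformity leaves the
topology unchanged, so by minimality the pullback was already coarser. -/
theorem Continuous.uniformContinuous_fineUniformity [CompletelyRegularSpace X] {Z : Type*}
    [uZ : UniformSpace Z] {F : X → Z} (hF : Continuous F) :
    @UniformContinuous X Z (fineUniformity X) uZ F := by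
  have hle := (isLeast_fineUniformity X).1
  rw [uniformContinuous_iff_le_comap]
  refine (sInf_le (a := UniformSpace.comap F uZ ⊓ fineUniformity X) ?_).trans inf_le_left
  change (UniformSpace.comap F uZ ⊓ fineUniformity X).toTopologicalSpace = _
  rw [UniformSpace.toTopologicalSpace_inf, UniformSpace.toTopologicalSpace_comap,
    show (fineUniformity X).toTopologicalSpace = _ from hle]
  exact inf_eq_right.2 hF.le_induced

theorem cauchy_map_of_mem_dieudonneCompletion [CompletelyRegularSpace X] {Z : Type*}
    [UniformSpace Z] {F : X → Z} (hF : Continuous F) {p : StoneCech X}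
    (hp : p ∈ dieudonneCompletion X) : Cauchy (map F (comap stoneCechUnit (𝓝 p))) :=
  @Cauchy.map X Z (fineUniformity X) _ _ _ hp hF.uniformContinuous_fineUniformity

theorem dieudonneCompletion_subset_hewittRealcompactification [CompletelyRegularSpace X] :
    dieudonneCompletion X ⊆ hewittRealcompactification X := fun _ hp f =>
  CompleteSpace.complete (cauchy_map_of_mem_dieudonneCompletion f.continuous hp)

theorem range_stoneCechUnit_subset_dieudonneCompletion [CompletelyRegularSpace X] :
    range (stoneCechUnit : X → StoneCech X) ⊆ dieudonneCompletion X := by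
  rintro _ ⟨x, rfl⟩
  change @Cauchy X (fineUniformity X) _
  rw [← (isInducing_stoneCechUnit (X := X)).nhds_eq_comap]
  have h := @cauchy_nhds X (fineUniformity X) x
  rwa [show (fineUniformity X).toTopologicalSpace = _ from (isLeast_fineUniformity X).1] at h

/-- A space embeds in a complete uniform space in such a way that its fine uniformity is
induced. -/
theorem exists_completeSpace_comap_eq_fineUniformity [CompletelyRegularSpace X] :
    ∃ (Z : Type u) (uZ : UniformSpace Z) (_ : CompleteSpace Z) (_ : T0Space Z) (F : X → Z),
      Continuous F ∧ UniformSpace.comap F uZ = fineUniformity X := by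
  refine ⟨@UniformSpace.Completion X (fineUniformity X),
    @UniformSpace.Completion.uniformSpace X (fineUniformity X),
    @UniformSpace.Completion.completeSpace X (fineUniformity X),
    @UniformSpace.Completion.t0Space X (fineUniformity X),
    @UniformSpace.Completion.coe' X (fineUniformity X), ?_, ?_⟩
  · have h := @UniformSpace.Completion.continuous_coe X (fineUniformity X)
    rwa [show (fineUniformity X).toTopologicalSpace = _ from (isLeast_fineUniformity X).1] at h
  · exact @IsUniformInducing.comap_uniformSpace _ _ (fineUniformity X) _ _
      (@UniformSpace.Completion.isUniformInducing_coe X (fineUniformity X))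

end FineUniformity

/-! ### Spaces between `X` and `βX` -/

section Intermediate

variable {X : Type u} [TopologicalSpace X] {Y : Set (StoneCech X)}

/-- The canonical map of `X` into an intermediate space `X ⊆ Y ⊆ βX`. -/
def toIntermediate (hY : range (stoneCechUnit : X → StoneCech X) ⊆ Y) : C(X, Y) where
  toFun x := ⟨stoneCechUnit x, hY (mem_range_self x)⟩
  continuous_toFun := continuous_stoneCechUnit.subtype_mk _

theorem denseRange_toIntermediate (hY : range (stoneCechUnit : X → StoneCech X) ⊆ Y) :
    DenseRange (toIntermediate hY) := by
  intro p
  rw [IsInducing.subtypeVal.closure_eq_preimage_closure_image, mem_preimage, ← range_comp]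
  exact denseRange_stoneCechUnit p.1

theorem comap_toIntermediate_nhds (hY : range (stoneCechUnit : X → StoneCech X) ⊆ Y) (p : Y) :
    comap (toIntermediate hY) (𝓝 p) = comap stoneCechUnit (𝓝 (p : StoneCech X)) := by
  rw [nhds_subtype, comap_comap]
  rfl

theorem isInducing_toIntermediate [CompletelyRegularSpace X]
    (hY : range (stoneCechUnit : X → StoneCech X) ⊆ Y) : IsInducing (toIntermediate hY) :=
  .of_comp (toIntermediate hY).continuous continuous_subtype_val
    (isInducing_stoneCechUnit (X := X))

end Intermediate

/-! ### Inheritance of the Ascoli properties -/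

section Ascoli

variable {X : Type u} [TopologicalSpace X] {Y : Set (StoneCech X)}

/-- A space between an Ascoli space and its Dieudonné completion is Ascoli. -/
theorem IsAscoliSpace.intermediate [CompletelyRegularSpace X] (hX : IsAscoliSpace X)
    (hY : range (stoneCechUnit : X → StoneCech X) ⊆ Y) (hYD : Y ⊆ dieudonneCompletion X) :
    IsAscoliSpace Y := by
  intro K hK
  set i := toIntermediate hY
  have hK' : IsCompact ((fun f : C(Y, ℝ) => f.comp i) '' K) :=
    hK.image (ContinuousMap.continuous_precomp i)
  set K' := (fun f : C(Y, ℝ) => f.comp i) '' K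
  have : CompactSpace K' := isCompact_iff_compactSpace.1 hK'
  let F : C(X, C(K', ℝ)) := ContinuousMap.curry ⟨_, hX K' hK'⟩
  have key : ∀ p : Y, ∀ ε > 0, ∀ᶠ q in 𝓝 p, ∀ k : K, |(k : C(Y, ℝ)) q - (k : C(Y, ℝ)) p| ≤ ε := by
    intro p ε hε
    obtain ⟨S, hS, hSε⟩ := (Metric.cauchy_iff.1
      (cauchy_map_of_mem_dieudonneCompletion F.continuous (hYD p.2))).2 ε hε
    rw [mem_map, ← comap_toIntermediate_nhds hY] at hS
    refine (denseRange_toIntermediate hY).eventually_abs_sub_le hS _ fun k x hx y hy => ?_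
    exact (ContinuousMap.dist_apply_le_dist (f := F x) (g := F y)
      (⟨_, mem_image_of_mem _ k.2⟩ : K')).trans (hSε _ hx _ hy).le
  -- Move the point first, uniformly over `K` by `key`, then move the function at the fixed point
  -- `p`.
  refine continuous_iff_continuousAt.2 fun ⟨p, k⟩ => Metric.tendsto_nhds.2 fun ε hε => ?_
  have hk : ∀ᶠ k' : K in 𝓝 k, dist ((k' : C(Y, ℝ)) p) ((k : C(Y, ℝ)) p) < ε / 2 :=
    Metric.tendsto_nhds.1
      ((continuous_eval_const p).comp continuous_subtype_val).continuousAt _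
      (half_pos hε)
  rw [nhds_prod_eq]
  filter_upwards [(key p (ε / 2) (half_pos hε)).prod_mk hk] with a ha
  have := ha.1 a.2
  rw [← Real.dist_eq] at this
  exact (dist_triangle _ ((a.2 : C(Y, ℝ)) p) _).trans_lt (by linarith [ha.2])

/-- A countable cover of `X` by functionally open sets has a member that is a trace of a
neighbourhood of a given point of the realcompactification. -/
theorem exists_eventually_lt_of_mem_hewittRealcompactification {p : StoneCech X}
    (hp : p ∈ hewittRealcompactification X) (w : ℕ → C(X, ℝ)) {ε : ℝ}
    (hw₀ : ∀ n x, 0 ≤ w n x) (hw : ∀ x, ∃ n, w n x < ε) :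
    ∃ n, ∀ᶠ x in comap stoneCechUnit (𝓝 p), w n x < ε := by
  by_contra! hcon
  have : NeBot (comap (stoneCechUnit : X → StoneCech X) (𝓝 p)) := by
    refine ⟨fun h => hcon 0 ?_⟩
    rw [h]
    exact eventually_bot
  have hnn : ∀ n x, 0 ≤ (1 / 2 : ℝ) ^ n * max 0 (ε - w n x) := fun n x => by positivity
  have hbd : ∀ n x, ‖(1 / 2 : ℝ) ^ n * max 0 (ε - w n x)‖ ≤ (1 / 2 : ℝ) ^ n * |ε| := by
    intro n x
    rw [Real.norm_of_nonneg (hnn n x)]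
    refine mul_le_mul_of_nonneg_left ?_ (by positivity)
    exact max_le (abs_nonneg _) ((sub_le_self _ (hw₀ n x)).trans (le_abs_self _))
  have hsum : Summable fun n : ℕ => (1 / 2 : ℝ) ^ n * |ε| := summable_geometric_two.mul_right _
  -- `u` is positive because the sets `w n < ε` cover `X`. If none is a trace, every `w n` has limit
  -- at least `ε` at `p`, so `u → 0` there, although `1 / u` must have a finite limit.
  let u : X → ℝ := fun x => ∑' n, (1 / 2 : ℝ) ^ n * max 0 (ε - w n x)
  have hu : Continuous u := continuous_tsum (fun n => by fun_prop) hsum hbd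
  have hpos : ∀ x, 0 < u x := by
    intro x
    obtain ⟨n, hn⟩ := hw x
    refine (hsum.of_norm_bounded fun n => hbd n x).tsum_pos (fun n => hnn n x) n ?_
    exact mul_pos (by positivity) (lt_max_of_lt_right (sub_pos.2 hn))
  have hu₀ : Tendsto u (comap stoneCechUnit (𝓝 p)) (𝓝 0) := by
    have h := tendsto_tsum_of_dominated_convergence (𝓕 := comap stoneCechUnit (𝓝 p))
      (f := fun x n => (1 / 2 : ℝ) ^ n * max 0 (ε - w n x)) (g := fun _ => 0) hsum ?_
      (Eventually.of_forall fun x n => hbd n x)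
    · simpa only [tsum_zero] using h
    · intro n
      obtain ⟨r, hr⟩ := hp (w n)
      have hrε : ε ≤ r := by
        by_contra! hlt
        exact hcon n ((hr.eventually_lt_const hlt).mono fun _ => not_le.2)
      have := ((tendsto_const_nhds (x := (0 : ℝ))).max (hr.const_sub ε)).const_mul
        ((1 / 2 : ℝ) ^ n)
      rwa [max_eq_left (sub_nonpos.2 hrε), mul_zero] at this
  obtain ⟨r, hr⟩ := hp ⟨fun x => (u x)⁻¹, hu.inv₀ fun x => (hpos x).ne'⟩
  have h1 := hu₀.mul hr
  simp only [ContinuousMap.coe_mk, mul_inv_cancel₀ (hpos _).ne', zero_mul] at h1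
  exact one_ne_zero (tendsto_nhds_unique tendsto_const_nhds h1)

/-- Tail suprema of an equicontinuous sequence are continuous. -/
theorem continuous_iSup_min_abs {h : ℕ → X → ℝ} (hh : Equicontinuous h) :
    Continuous fun x => ⨆ n, min 1 |h n x| := by
  have hbdd : ∀ x, BddAbove (range fun n => min 1 |h n x|) := fun x =>
    ⟨1, by rintro _ ⟨n, rfl⟩; exact min_le_left _ _⟩
  have hle : ∀ ε x y, (∀ n, |h n x - h n y| ≤ ε) →
      (⨆ n, min 1 |h n x|) ≤ (⨆ n, min 1 |h n y|) + ε := by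
    intro ε x y hxy
    refine ciSup_le fun n => ?_
    have h₀ := (abs_nonneg _).trans (hxy n)
    have h₁ := le_ciSup (hbdd y) n
    have h₂ : |h n x| ≤ |h n y| + ε := by
      linarith [abs_sub_abs_le_abs_sub (h n x) (h n y), hxy n]
    refine le_trans ?_ (add_le_add_left h₁ ε)
    rw [← min_add_add_right]
    exact min_le_min (by linarith) h₂
  refine continuous_iff_continuousAt.2 fun x => Metric.tendsto_nhds.2 fun ε hε => ?_
  filter_upwards [Metric.equicontinuousAt_iff_right.1 (hh x) (ε / 2) (half_pos hε)] with y hy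
  have hy' : ∀ n, |h n x - h n y| ≤ ε / 2 := fun n => (Real.dist_eq _ _ ▸ hy n).le
  rw [Real.dist_eq, abs_sub_lt_iff]
  have h₁ := hle _ x y hy'
  have h₂ := hle _ y x fun n => by rw [abs_sub_comm]; exact hy' n
  constructor <;> linarith

/-- A space between a sequentially Ascoli space and its realcompactification is sequentially
Ascoli. -/
theorem IsSequentiallyAscoliSpace.intermediate (hX : IsSequentiallyAscoliSpace X)
    (hY : range (stoneCechUnit : X → StoneCech X) ⊆ Y)
    (hYυ : Y ⊆ hewittRealcompactification X) : IsSequentiallyAscoliSpace Y := by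
  intro f g hfg p
  set i := toIntermediate hY
  have hfi : Tendsto (fun n => (f n).comp i) atTop (𝓝 (g.comp i)) :=
    ((ContinuousMap.continuous_precomp i).tendsto g).comp hfg
  have heq : Equicontinuous fun (n : ℕ) (x : X) => f n (i x) - g (i x) := by
    intro x
    refine Metric.equicontinuousAt_iff_right.2 fun ε hε => ?_
    filter_upwards [Metric.equicontinuousAt_iff_right.1 (hX _ _ hfi x) (ε / 2) (half_pos hε),
      Metric.tendsto_nhds.1 (g.comp i).continuous.continuousAt (ε / 2) (half_pos hε)] with y h₁ h₂ n
    have h₁ := h₁ n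
    simp only [ContinuousMap.comp_apply, Real.dist_eq, abs_lt] at h₁ h₂ ⊢
    constructor <;> linarith [h₁.1, h₁.2, h₂.1, h₂.2]
  have htail : ∀ N, Equicontinuous fun (n : ℕ) (x : X) => f (N + n) (i x) - g (i x) :=
    fun N x => (heq x).comp (N + ·)
  let w : ℕ → C(X, ℝ) := fun N => ⟨_, continuous_iSup_min_abs (htail N)⟩
  have hbdd : ∀ N x, BddAbove (range fun n => min 1 |f (N + n) (i x) - g (i x)|) := fun N x =>
    ⟨1, by rintro _ ⟨n, rfl⟩; exact min_le_left _ _⟩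
  refine Metric.equicontinuousAt_iff_right.2 fun ε hε => ?_
  -- `δ < 1` undoes the truncation at 1; `3 * δ` pays for the path `f n p`, `g p`, `g q`, `f n q`.
  obtain ⟨δ, hδ, hδ1, hδε⟩ : ∃ δ : ℝ, 0 < δ ∧ δ < 1 ∧ 3 * δ < ε :=
    ⟨min (1 / 2) (ε / 4), by positivity, (min_le_left _ _).trans_lt (by norm_num), by
      linarith [min_le_right (1 / 2) (ε / 4)]⟩
  obtain ⟨N, hN⟩ := exists_eventually_lt_of_mem_hewittRealcompactification (hYυ p.2) w (ε := δ)
    (fun N x => Real.iSup_nonneg fun n => by positivity) fun x => by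
      have hx : Tendsto (fun n => f n (i x)) atTop (𝓝 (g (i x))) :=
        ((continuous_eval_const (i x)).tendsto g).comp hfg
      obtain ⟨N, hN⟩ := eventually_atTop.1 (Metric.tendsto_nhds.1 hx (δ / 2) (half_pos hδ))
      refine ⟨N, lt_of_le_of_lt (ciSup_le fun n => ?_) (half_lt_self hδ)⟩
      exact (min_le_right _ _).trans (hN _ (Nat.le_add_right _ _)).le
  rw [← comap_toIntermediate_nhds hY] at hN
  obtain ⟨U, hU, hUC⟩ := (denseRange_toIntermediate hY).exists_mem_nhds_subset_isClosed hN
  have hfar : ∀ n, ∀ q ∈ U, |f (N + n) q - g q| ≤ δ := fun n =>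
    hUC {q | |f (N + n) q - g q| ≤ δ} (isClosed_le (by fun_prop) continuous_const) fun x hx => by
      have h₁ : min 1 |f (N + n) (i x) - g (i x)| < δ := (le_ciSup (hbdd N x) n).trans_lt hx
      exact ((min_lt_iff.1 h₁).resolve_left hδ1.not_gt).le
  -- The finitely many functions before the tail need only their own continuity.
  have hnear : ∀ᶠ q in 𝓝 p, ∀ n < N, dist (f n p) (f n q) < ε :=
    (eventually_all_finite (finite_lt_nat N)).2 fun n _ => by
      filter_upwards [Metric.tendsto_nhds.1 (f n).continuous.continuousAt ε hε] with q hq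
      rwa [dist_comm]
  filter_upwards [hU, hnear, Metric.tendsto_nhds.1 g.continuous.continuousAt δ hδ]
    with q hq h₁ h₂ n
  rcases lt_or_ge n N with hn | hn
  · exact h₁ n hn
  · obtain ⟨m, rfl⟩ := Nat.exists_eq_add_of_le hn
    have h₃ := hfar m q hq
    have h₄ := hfar m p (mem_of_mem_nhds hU)
    rw [Real.dist_eq, abs_lt] at *
    rw [abs_le] at h₃ h₄
    constructor <;> linarith [h₃.1, h₃.2, h₄.1, h₄.2, h₂.1, h₂.2]

end Ascoli

/-! ### The Dieudonné completion as a `μ`-space -/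

section MuSpace

/-- Functionally bounded subsets of uniform spaces are totally bounded. -/
theorem IsFunctionallyBounded.totallyBounded {Z : Type u} [UniformSpace Z] {B : Set Z}
    (hB : IsFunctionallyBounded B) : TotallyBounded B := by
  by_contra hcon
  simp only [TotallyBounded, not_forall, not_exists, not_and] at hcon
  obtain ⟨V, hV, hVB⟩ := hcon
  obtain ⟨V₁, hV₁, hV₁s, hV₁V⟩ := comp_symm_of_uniformity hV
  obtain ⟨W, hW, hWs, hWV⟩ := comp_symm_of_uniformity hV₁
  obtain ⟨b, hbB, hb⟩ : ∃ b : ℕ → Z, (∀ n, b n ∈ B) ∧ ∀ m n, m < n → (b n, b m) ∉ V := by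
    refine exists_seq_of_forall_finset_exists (· ∈ B) (fun x y => (y, x) ∉ V) fun t _ => ?_
    obtain ⟨y, hy, hyt⟩ := not_subset.1 (hVB t t.finite_toSet)
    exact ⟨y, hy, fun x hx hxy => hyt (mem_biUnion hx hxy)⟩
  -- A `W`-ball meeting the `W`-balls of `b m` and `b n` links these points by four `W`-steps, hence
  -- within `V`. Used in both orders this gives `m = n`, so the balls form a discrete family.
  have hfar : ∀ m n z x y, (b m, x) ∈ W → (z, x) ∈ W → (b n, y) ∈ W → (z, y) ∈ W → m ≤ n := by
    intro m n z x y h₁ h₂ h₃ h₄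
    by_contra! hlt
    exact hb n m hlt (hV₁V ⟨z, hWV ⟨x, h₁, hWs h₂⟩, hWV ⟨y, h₄, hWs h₃⟩⟩)
  have hφ : ∀ n, ∃ φ : Z → unitInterval, Continuous φ ∧ φ (b n) = 0 ∧
      EqOn φ 1 (interior (UniformSpace.ball (b n) W))ᶜ := fun n =>
    CompletelyRegularSpace.completely_regular_isOpen _ _ isOpen_interior
      (mem_interior_iff_mem_nhds.2 (UniformSpace.ball_mem_nhds _ hW))
  choose φ hφc hφ₀ hφ₁ using hφ
  -- Bumps of height `n` at `b n`: their locally finite sum is continuous but unbounded on `B`.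
  let f : ℕ → Z → ℝ := fun n z => n * (1 - φ n z)
  have hsupp : ∀ n, Function.support (f n) ⊆ UniformSpace.ball (b n) W := by
    intro n x hx
    by_contra hxW
    refine hx ?_
    have := hφ₁ n (x := x) fun h => hxW (interior_subset h)
    simp [f, this]
  have hlf : LocallyFinite fun n => Function.support (f n) := by
    intro z
    refine ⟨_, UniformSpace.ball_mem_nhds z hW, Set.Subsingleton.finite ?_⟩
    rintro m ⟨x, hx, hzx⟩ n ⟨y, hy, hzy⟩
    exact le_antisymm (hfar m n z x y (hsupp m hx) hzx (hsupp n hy) hzy)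
      (hfar n m z y x (hsupp n hy) hzy (hsupp m hx) hzx)
  have hc : Continuous fun z => ∑ᶠ n, f n z :=
    continuous_finsum (fun n => by have := hφc n; fun_prop) hlf
  have hval : ∀ n, ∑ᶠ m, f m (b n) = n := by
    intro n
    rw [finsum_eq_single _ n]
    · simp [f, hφ₀]
    · intro m hmn
      by_contra hm
      have hmW := hsupp m hm
      have hnn : (b n, b n) ∈ W := refl_mem_uniformity hW
      exact hmn (le_antisymm (hfar m n _ _ _ hmW hnn hnn hnn) (hfar n m _ _ _ hnn hnn hmW hnn))
  obtain ⟨C, hC⟩ := (hB ⟨_, hc⟩).exists_norm_le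
  obtain ⟨n, hn⟩ := exists_nat_gt C
  have := hC _ (mem_image_of_mem _ (hbB n))
  rw [ContinuousMap.coe_mk, hval, Real.norm_natCast] at this
  exact this.not_gt hn

theorem IsFunctionallyBounded.image {Y Z : Type u} [TopologicalSpace Y] [TopologicalSpace Z]
    {A : Set Y} (hA : IsFunctionallyBounded A) {F : Y → Z} (hF : Continuous F) :
    IsFunctionallyBounded (F '' A) := fun f => by
  rw [image_image]
  exact hA (f.comp ⟨F, hF⟩)

/-- The Dieudonné completion is a `μ`-space. -/
theorem isMuSpace_dieudonneCompletion (X : Type u) [TopologicalSpace X]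
    [CompletelyRegularSpace X] : IsMuSpace (dieudonneCompletion X) := by
  intro A hA
  obtain ⟨Z, _, _, _, F, hF, hcomap⟩ := exists_completeSpace_comap_eq_fineUniformity (X := X)
  have hD := range_stoneCechUnit_subset_dieudonneCompletion (X := X)
  have hi : IsDenseInducing (toIntermediate hD) :=
    ⟨isInducing_toIntermediate hD, denseRange_toIntermediate hD⟩
  have hlim : ∀ q, ∃ z, Tendsto F (comap (toIntermediate hD) (𝓝 q)) (𝓝 z) := fun q => by
    rw [comap_toIntermediate_nhds]
    exact CompleteSpace.complete (cauchy_map_of_mem_dieudonneCompletion hF q.2)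
  have hG : Continuous (hi.extend F) := hi.continuous_extend hlim
  have key : closure (Subtype.val '' A) ⊆ dieudonneCompletion X := by
    intro p hp
    obtain ⟨𝒰, hA𝒰, h𝒰p⟩ := mem_closure_iff_ultrafilter.1 hp
    let 𝒱 := Ultrafilter.ofComapInfPrincipal hA𝒰
    have h𝒱 : Tendsto Subtype.val (𝒱 : Filter (dieudonneCompletion X)) (𝓝 p) := by
      rw [Tendsto, ← Ultrafilter.coe_map, Ultrafilter.ofComapInfPrincipal_eq_of_map]
      exact h𝒰p
    have hGA : Cauchy (𝒱.map (hi.extend F) : Filter Z) :=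
      totallyBounded_iff_ultrafilter.1 (hA.image hG).totallyBounded _ <| le_principal_iff.2 <|
        image_mem_map (Ultrafilter.ofComapInfPrincipal_mem hA𝒰)
    obtain ⟨z, hz⟩ := CompleteSpace.complete hGA
    -- Test a neighbourhood of `z` by a function `φ` vanishing at `z` and equal to 1 off it. The
    -- extension of `φ ∘ F` to `βX` agrees with `φ ∘ hi.extend F` on the Dieudonné completion, so it
    -- vanishes at `p` and differs from 1 nearby.
    have hFz : Tendsto F (comap stoneCechUnit (𝓝 p)) (𝓝 z) := by
      intro s hs
      obtain ⟨φ, hφ, hφ₀, hφ₁⟩ := CompletelyRegularSpace.completely_regular_isOpen z _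
        isOpen_interior (mem_interior_iff_mem_nhds.2 hs)
      have hh := continuous_stoneCechExtend (hφ.comp hF)
      have heq : stoneCechExtend (hφ.comp hF) ∘ Subtype.val = φ ∘ hi.extend F :=
        hi.dense.equalizer (hh.comp continuous_subtype_val) (hφ.comp hG) <| funext fun x =>
          (stoneCechExtend_stoneCechUnit (hφ.comp hF) x).trans
            (congrArg φ (hi.extend_eq' hlim x).symm)
      have hp₀ : stoneCechExtend (hφ.comp hF) p = 0 := by
        refine tendsto_nhds_unique ((hh.tendsto p).comp h𝒱) ?_
        rw [heq, ← hφ₀]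
        exact (hφ.tendsto z).comp hz
      refine ⟨_, hh.continuousAt.eventually_ne (y := 1) (by rw [hp₀]; exact zero_ne_one),
        fun x hx => mem_preimage.2 (interior_subset ?_)⟩
      by_contra hxs
      exact hx ((stoneCechExtend_stoneCechUnit (hφ.comp hF) x).trans (hφ₁ hxs))
    change @Cauchy X (fineUniformity X) _
    -- The universal uniformity is pulled back along `F`, so convergence of `F` makes the trace of
    -- `p` Cauchy.
    rw [← hcomap, cauchy_comap_uniformSpace]
    have := (isDenseInducing_stoneCechUnit (X := X)).comap_nhds_neBot p
    exact cauchy_nhds.mono hFz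
  rw [IsInducing.subtypeVal.closure_eq_preimage_closure_image]
  refine (IsInducing.subtypeVal.isCompact_preimage_iff ?_).2 isClosed_closure.isCompact
  simpa using key

end MuSpace

theorem theorem3p8 {X : Type u} [TopologicalSpace X] [T35Space X] :
    (∀ Y : Set (StoneCech X), range (stoneCechUnit : X → StoneCech X) ⊆ Y →
      (IsAscoliSpace X → Y ⊆ dieudonneCompletion X → IsAscoliSpace Y) ∧
      (IsSequentiallyAscoliSpace X → Y ⊆ hewittRealcompactification X →
        IsSequentiallyAscoliSpace Y)) ∧
    (IsAscoliSpace X →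
      IsAscoliSpace (muCompletion X) ∧ IsAscoliSpace (dieudonneCompletion X)) ∧
    (IsSequentiallyAscoliSpace X →
      IsSequentiallyAscoliSpace (muCompletion X) ∧
      IsSequentiallyAscoliSpace (dieudonneCompletion X)) := by
  have hD := range_stoneCechUnit_subset_dieudonneCompletion (X := X)
  have hDυ := dieudonneCompletion_subset_hewittRealcompactification (X := X)
  have hμ := (isLeast_muCompletion X).1.1
  have hμD : muCompletion X ⊆ dieudonneCompletion X :=
    (isLeast_muCompletion X).2 ⟨hD, isMuSpace_dieudonneCompletion X⟩
  exact ⟨fun Y hY => ⟨fun h => h.intermediate hY, fun h => h.intermediate hY⟩,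
    fun h => ⟨h.intermediate hμ hμD, h.intermediate hD subset_rfl⟩,
    fun h => ⟨h.intermediate hμ (hμD.trans hDυ), h.intermediate hD hDυ⟩⟩
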